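/- Let $\{W(t), t\ge 0\}$ be a standard Brownian motion, let $0<a<b<\infty$, and put $\beta_{[a,b]}:=\inf_{a\le t\le b}|W(t)|$. Then for every $\eta>0$, $$\mathbf P\{0<\beta_{[a,b]}\le \eta\}\le \frac{16\,\eta}{\sqrt{2\pi}}\,\min\Big(\frac1{\sqrt{b-a}},\frac1{\sqrt a}\Big).$$ Further, for every real $\alpha$ with $0\le\alpha<1$, the random variable $\beta_{[a,b]}^{-\alpha}\cdot\mathbf 1_{\{\beta_{[a,b]}>0\}}$ is integrable and $$\mathbf E\big[\beta_{[a,b]}^{-\alpha}\cdot\mathbf 1_{\{\beta_{[a,b]}>0\}}\big]\le \frac{47}{1-\alpha}\,\min\Big(\frac1{\sqrt{b-a}},\frac1{\sqrt a}\Big)+1.$$ -/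

import Mathlib

open MeasureTheory ProbabilityTheory
open scoped NNReal

/-- The local infimum `β_{[a,b]} = inf_{a ≤ t ≤ b} |W(t)|` of a real process `W` indexed by the
nonnegative half-line. The family is bounded below by `0`, and it is nonempty when `a ≤ b`. -/
noncomputable def localInf {Ω : Type*} (W : ℝ≥0 → Ω → ℝ) (a b : ℝ≥0) (ω : Ω) : ℝ :=
  ⨅ t : Set.Icc a b, |W t ω|

section Discrete

variable {Ω : Type*} [MeasurableSpace Ω] {P : Measure Ω}

/-- Lower semicontinuity of a finite measure along the lower limit of a sequence of sets. -/
theorem eventually_measureReal_le_add [IsFiniteMeasure P] {A : Set Ω} {s : ℕ → Set Ω}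
    (h : ∀ᵐ ω ∂P, ω ∈ A → ∀ᶠ n in Filter.atTop, ω ∈ s n) {δ : ℝ} (hδ : 0 < δ) :
    ∀ᶠ n in Filter.atTop, P.real A ≤ P.real (s n) + δ := by
  let t : ℕ → Set Ω := fun N ↦ ⋂ n ≥ N, s n
  have ht : Monotone t := fun N N' hN ω hω ↦ by
    simp only [t, Set.mem_iInter] at hω ⊢
    exact fun n hn ↦ hω n (hN.trans hn)
  have hA : P A ≤ P (⋃ N, t N) := by
    refine measure_mono_ae ?_
    filter_upwards [h] with ω hω hωA
    obtain ⟨N, hN⟩ := Filter.eventually_atTop.1 (hω hωA)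
    exact Set.mem_iUnion.2 ⟨N, Set.mem_iInter₂.2 hN⟩
  have hlim : Filter.Tendsto (fun N ↦ P.real (t N)) Filter.atTop (nhds (P.real (⋃ N, t N))) :=
    (ENNReal.tendsto_toReal (measure_ne_top _ _)).comp (tendsto_measure_iUnion_atTop ht)
  have hA' : P.real A ≤ P.real (⋃ N, t N) := ENNReal.toReal_mono (measure_ne_top _ _) hA
  filter_upwards [hlim.eventually_const_lt (show P.real (⋃ N, t N) - δ < _ by linarith)] with n hn
  have : P.real (t n) ≤ P.real (s n) :=
    measureReal_mono (Set.iInter₂_subset n le_rfl)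
  linarith

/-- If every section of a measurable set in the first variable has probability at most `C` under
the law of `X`, so does the whole set under the law of an independent pair `(X, Y)`. -/
theorem measureReal_pair_le_of_forall [IsProbabilityMeasure P] {α β : Type*} [MeasurableSpace α]
    [MeasurableSpace β] {X : Ω → α} {Y : Ω → β} (hX : AEMeasurable X P) (hY : AEMeasurable Y P)
    (hXY : IndepFun X Y P) {B : Set (α × β)} (hB : MeasurableSet B) {C : ℝ} (hC : 0 ≤ C)
    (h : ∀ y, P.real {ω | (X ω, y) ∈ B} ≤ C) : P.real {ω | (X ω, Y ω) ∈ B} ≤ C := by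
  have := Measure.isProbabilityMeasure_map hX
  have := Measure.isProbabilityMeasure_map hY
  refine ENNReal.toReal_le_of_le_ofReal hC ?_
  have e : P {ω | (X ω, Y ω) ∈ B} = ((P.map X).prod (P.map Y)) B := by
    rw [← hXY.map_prod_eq_prod_map_map hX hY, Measure.map_apply_of_aemeasurable
      (hX.prodMk hY) hB]
    rfl
  rw [e, Measure.prod_apply_symm hB]
  calc ∫⁻ y, P.map X ((fun x ↦ (x, y)) ⁻¹' B) ∂(P.map Y)
      ≤ ∫⁻ _, ENNReal.ofReal C ∂(P.map Y) := by
        refine lintegral_mono fun y ↦ ?_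
        rw [Measure.map_apply_of_aemeasurable hX (measurable_prodMk_right hB)]
        exact (ENNReal.le_ofReal_iff_toReal_le (measure_ne_top _ _) hC).2 (h y)
    _ = ENNReal.ofReal C := by simp

/-- The event that the sequence `S` first reaches the level `u` at time `k`. -/
def firstPassage (S : ℕ → Ω → ℝ) (u : ℝ) (k : ℕ) : Set Ω :=
  {ω | u ≤ S k ω ∧ ∀ j < k, S j ω < u}

theorem measureReal_diff_of_subset [IsFiniteMeasure P] {A B : Set Ω} (h : B ⊆ A)
    (hB : NullMeasurableSet B P) : P.real (A \ B) = P.real A - P.real B := by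
  rw [Measure.real, measure_sdiff h hB (measure_ne_top _ _),
    ENNReal.toReal_sub_of_le (measure_mono h) (measure_ne_top _ _)]
  rfl

omit [MeasurableSpace Ω] in
theorem firstPassage_eq_preimage (S : ℕ → Ω → ℝ) (u : ℝ) (k : ℕ) :
    firstPassage S u k = (fun ω (j : Fin (k + 1)) ↦ S j ω) ⁻¹'
      {x | u ≤ x (Fin.last k) ∧ ∀ j : Fin k, x j.castSucc < u} := by
  ext ω
  simp [firstPassage, Fin.forall_iff]

theorem measurableSet_firstPassage_cylinder (u : ℝ) (k : ℕ) :
    MeasurableSet {x : Fin (k + 1) → ℝ | u ≤ x (Fin.last k) ∧ ∀ j : Fin k, x j.castSucc < u} := by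
  refine (measurableSet_le measurable_const (measurable_pi_apply _)).inter ?_
  have : {x : Fin (k + 1) → ℝ | ∀ j : Fin k, x j.castSucc < u} =
      ⋂ j : Fin k, {x : Fin (k + 1) → ℝ | x j.castSucc < u} := by ext; simp
  change MeasurableSet {x : Fin (k + 1) → ℝ | ∀ j : Fin k, x j.castSucc < u}
  rw [this]
  exact MeasurableSet.iInter fun j ↦ measurableSet_lt (measurable_pi_apply _) measurable_const

omit [MeasurableSpace Ω] in
theorem disjoint_firstPassage (S : ℕ → Ω → ℝ) (u : ℝ) :
    Pairwise (Function.onFun Disjoint (firstPassage S u)) := by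
  intro i j hij
  rw [Function.onFun, Set.disjoint_left]
  rintro ω ⟨h1, h2⟩ ⟨h3, h4⟩
  rcases lt_or_gt_of_ne hij with h | h
  · exact absurd h1 (not_le.2 (h4 i h))
  · exact absurd h3 (not_le.2 (h2 j h))

omit [MeasurableSpace Ω] in
theorem exists_firstPassage {S : ℕ → Ω → ℝ} {u : ℝ} {n : ℕ} {ω : Ω} (h : ∃ k ≤ n, u ≤ S k ω) :
    ∃ k ≤ n, ω ∈ firstPassage S u k := by
  classical
  have h' : ∃ k, u ≤ S k ω := ⟨h.choose, h.choose_spec.2⟩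
  refine ⟨Nat.find h', ?_, Nat.find_spec h', fun j hj ↦ not_le.1 (Nat.find_min h' hj)⟩
  obtain ⟨k, hk, hk'⟩ := h
  exact (Nat.find_min' h' hk').trans hk

theorem nullMeasurableSet_firstPassage {S : ℕ → Ω → ℝ} (hS : ∀ k, AEMeasurable (S k) P) (u : ℝ) (k : ℕ) :
    NullMeasurableSet (firstPassage S u k) P := by
  rw [firstPassage_eq_preimage]
  exact (aemeasurable_pi_lambda _ fun j : Fin (k + 1) ↦ hS j).nullMeasurableSet_preimage
    (measurableSet_firstPassage_cylinder u k)

variable {S : ℕ → Ω → ℝ} {n : ℕ}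

theorem measureReal_firstPassage_inter
    (hind : ∀ k ≤ n, IndepFun (fun ω (j : Fin (k + 1)) ↦ S j ω) (fun ω ↦ S n ω - S k ω) P)
    (u : ℝ) {k : ℕ} (hk : k ≤ n) {B : Set ℝ} (hB : MeasurableSet B) :
    P.real (firstPassage S u k ∩ {ω | S n ω - S k ω ∈ B}) =
      P.real (firstPassage S u k) * P.real {ω | S n ω - S k ω ∈ B} := by
  have := (hind k hk).measure_inter_preimage_eq_mul _ _
    (measurableSet_firstPassage_cylinder u k) hB
  rw [← firstPassage_eq_preimage] at this
  exact (congrArg ENNReal.toReal this).trans (ENNReal.toReal_mul ..)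

variable [IsProbabilityMeasure P]

theorem sum_measureReal_firstPassage_inter (hS : ∀ k, AEMeasurable (S k) P) (u : ℝ)
    (B : ℕ → Set Ω) (hB : ∀ k, NullMeasurableSet (B k) P) :
    ∑ k ∈ Finset.range (n + 1), P.real (firstPassage S u k ∩ B k) =
      P.real (⋃ k ∈ Finset.range (n + 1), firstPassage S u k ∩ B k) := by
  rw [Measure.real, measure_biUnion_finset₀, ENNReal.toReal_sum (fun _ _ ↦ measure_ne_top _ _)]
  · rfl
  · intro i _ j _ hij
    exact ((disjoint_firstPassage S u hij).mono Set.inter_subset_left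
      Set.inter_subset_left).aedisjoint
  · exact fun k _ ↦ (nullMeasurableSet_firstPassage hS u k).inter (hB k)

/-- Lévy's maximal inequality for partial sums whose remaining increments are nonnegative with
probability at least one half. -/
theorem measureReal_exists_le_le (hS : ∀ k, AEMeasurable (S k) P)
    (hind : ∀ k ≤ n, IndepFun (fun ω (j : Fin (k + 1)) ↦ S j ω) (fun ω ↦ S n ω - S k ω) P)
    (hhalf : ∀ k ≤ n, 1 ≤ 2 * P.real {ω | 0 ≤ S n ω - S k ω}) (u : ℝ) :
    P.real {ω | ∃ k ≤ n, u ≤ S k ω} ≤ 2 * P.real {ω | u ≤ S n ω} := by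
  calc P.real {ω | ∃ k ≤ n, u ≤ S k ω}
      ≤ P.real (⋃ k ∈ Finset.range (n + 1), firstPassage S u k) := by
        refine measureReal_mono (fun ω hω ↦ ?_) (measure_ne_top _ _)
        obtain ⟨k, hk, hk'⟩ := exists_firstPassage hω
        exact Set.mem_biUnion (Finset.mem_coe.2 (Finset.mem_range.2 (by omega))) hk'
    _ ≤ ∑ k ∈ Finset.range (n + 1), P.real (firstPassage S u k) :=
        measureReal_biUnion_finset_le _ _
    _ ≤ ∑ k ∈ Finset.range (n + 1),
          2 * P.real (firstPassage S u k ∩ {ω | 0 ≤ S n ω - S k ω}) := by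
        refine Finset.sum_le_sum fun k hk ↦ ?_
        have hk : k ≤ n := by simpa [Nat.lt_succ_iff] using hk
        have e := measureReal_firstPassage_inter hind u hk (measurableSet_Ici (a := (0 : ℝ)))
        simp only [Set.mem_Ici] at e
        rw [e]
        nlinarith [hhalf k hk, measureReal_nonneg (μ := P) (s := firstPassage S u k)]
    _ = 2 * P.real (⋃ k ∈ Finset.range (n + 1),
          firstPassage S u k ∩ {ω | 0 ≤ S n ω - S k ω}) := by
        rw [← Finset.mul_sum, sum_measureReal_firstPassage_inter hS]
        exact fun k ↦ nullMeasurableSet_le aemeasurable_const ((hS n).sub (hS k))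
    _ ≤ 2 * P.real {ω | u ≤ S n ω} := by
        refine mul_le_mul_of_nonneg_left (measureReal_mono (Set.iUnion₂_subset ?_)) two_pos.le
        rintro k - ω ⟨⟨h1, -⟩, h2⟩
        simp only [Set.mem_ofPred_eq] at h2 ⊢
        linarith

/-- A converse of Lévy's maximal inequality, up to the overshoot of a single step. -/
theorem two_mul_measureReal_le_exists_le (hS : ∀ k, AEMeasurable (S k) P)
    (h0 : ∀ ω, S 0 ω = 0)
    (hind : ∀ k ≤ n, IndepFun (fun ω (j : Fin (k + 1)) ↦ S j ω) (fun ω ↦ S n ω - S k ω) P)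
    (hhalf : ∀ k ≤ n, 2 * P.real {ω | 0 < S n ω - S k ω} ≤ 1) {u ε : ℝ} (hu : 0 ≤ u)
    (hε : 0 < ε) :
    2 * P.real {ω | u + ε ≤ S n ω} ≤ P.real {ω | ∃ k ≤ n, u ≤ S k ω} +
      2 * P.real {ω | ∃ k < n, ε ≤ S (k + 1) ω - S k ω} := by
  have hsub : {ω | u + ε ≤ S n ω} ⊆ (⋃ k ∈ Finset.range (n + 1),
      firstPassage S u k ∩ {ω | 0 < S n ω - S k ω}) ∪
        {ω | ∃ k < n, ε ≤ S (k + 1) ω - S k ω} := by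
    intro ω hω
    simp only [Set.mem_ofPred_eq] at hω
    by_cases hbad : ∃ k < n, ε ≤ S (k + 1) ω - S k ω
    · exact Or.inr hbad
    left
    push Not at hbad
    obtain ⟨k, hk, hk'⟩ := exists_firstPassage (S := S) (u := u) (n := n) (ω := ω)
      ⟨n, le_rfl, by linarith⟩
    refine Set.mem_biUnion (Finset.mem_coe.2 (Finset.mem_range.2 (by omega))) ⟨hk', ?_⟩
    simp only [Set.mem_ofPred_eq]
    rcases k with - | k
    · rw [h0]; linarith
    · have := hbad k (by omega)
      have := hk'.2 k (by omega)
      linarith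
  have h1 := (measureReal_mono (μ := P) hsub).trans (measureReal_union_le _ _)
  have h2 : 2 * P.real (⋃ k ∈ Finset.range (n + 1),
      firstPassage S u k ∩ {ω | 0 < S n ω - S k ω}) ≤ P.real {ω | ∃ k ≤ n, u ≤ S k ω} := by
    rw [← sum_measureReal_firstPassage_inter hS u (fun k ↦ {ω | 0 < S n ω - S k ω})
      (fun k ↦ nullMeasurableSet_lt aemeasurable_const ((hS n).sub (hS k))), Finset.mul_sum]
    calc ∑ k ∈ Finset.range (n + 1),
          2 * P.real (firstPassage S u k ∩ {ω | 0 < S n ω - S k ω})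
        ≤ ∑ k ∈ Finset.range (n + 1), P.real (firstPassage S u k ∩ Set.univ) := by
          refine Finset.sum_le_sum fun k hk ↦ ?_
          have hk : k ≤ n := by simpa [Nat.lt_succ_iff] using hk
          have e := measureReal_firstPassage_inter hind u hk (measurableSet_Ioi (a := (0 : ℝ)))
          simp only [Set.mem_Ioi] at e
          rw [e, Set.inter_univ]
          nlinarith [hhalf k hk, measureReal_nonneg (μ := P) (s := firstPassage S u k)]
      _ = P.real (⋃ k ∈ Finset.range (n + 1), firstPassage S u k ∩ Set.univ) :=
          sum_measureReal_firstPassage_inter hS u (fun _ ↦ Set.univ)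
            (fun _ ↦ MeasurableSet.univ.nullMeasurableSet)
      _ ≤ P.real {ω | ∃ k ≤ n, u ≤ S k ω} := by
          refine measureReal_mono (Set.iUnion₂_subset fun k hk ω hω ↦ ?_)
          exact ⟨k, by simpa [Nat.lt_succ_iff] using hk, hω.1.1⟩
  linarith

/-- Anti-concentration of the running maximum of a walk, in terms of its terminal value. -/
theorem measureReal_max_mem_le (hS : ∀ k, AEMeasurable (S k) P)
    (h0 : ∀ ω, S 0 ω = 0)
    (hind : ∀ k ≤ n, IndepFun (fun ω (j : Fin (k + 1)) ↦ S j ω) (fun ω ↦ S n ω - S k ω) P)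
    (hhalf : ∀ k ≤ n, 1 ≤ 2 * P.real {ω | 0 ≤ S n ω - S k ω})
    (hhalf' : ∀ k ≤ n, 2 * P.real {ω | 0 < S n ω - S k ω} ≤ 1) {u η ε : ℝ} (hu : 0 ≤ u)
    (hη : 0 < η) (hε : 0 < ε) :
    P.real {ω | (∃ k ≤ n, u ≤ S k ω) ∧ ∀ k ≤ n, S k ω < u + η} ≤
      2 * P.real {ω | u ≤ S n ω ∧ S n ω < u + η + ε} +
      2 * P.real {ω | ∃ k < n, ε ≤ S (k + 1) ω - S k ω} := by
  have hnull (v : ℝ) : NullMeasurableSet {ω | ∃ k ≤ n, v ≤ S k ω} P := by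
    have : {ω | ∃ k ≤ n, v ≤ S k ω} = ⋃ k ∈ Finset.range (n + 1), {ω | v ≤ S k ω} := by
      ext; simp
    rw [this]
    exact Finset.nullMeasurableSet_biUnion _ fun k _ ↦
      nullMeasurableSet_le aemeasurable_const (hS k)
  have e1 : {ω | (∃ k ≤ n, u ≤ S k ω) ∧ ∀ k ≤ n, S k ω < u + η} =
      {ω | ∃ k ≤ n, u ≤ S k ω} \ {ω | ∃ k ≤ n, u + η ≤ S k ω} := by
    ext; simp
  have e2 : {ω | u ≤ S n ω ∧ S n ω < u + η + ε} =
      {ω | u ≤ S n ω} \ {ω | u + η + ε ≤ S n ω} := by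
    ext; simp
  rw [e1, e2, measureReal_diff_of_subset _ (hnull _),
    measureReal_diff_of_subset _ (nullMeasurableSet_le aemeasurable_const (hS n))]
  · have h1 := measureReal_exists_le_le hS hind hhalf u
    have h2 := two_mul_measureReal_le_exists_le hS h0 hind hhalf' (add_nonneg hu hη.le) hε
    linarith
  · intro ω hω
    simp only [Set.mem_ofPred_eq] at hω ⊢
    linarith
  · rintro ω ⟨k, hk, hk'⟩
    exact ⟨k, hk, by linarith⟩

end Discrete

section Gaussian

variable {Ω : Type*} [MeasurableSpace Ω] {P : Measure Ω} {Z : Ω → ℝ} {v : ℝ≥0}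

theorem measureReal_neg_mem_of_gaussian (hZ : HasLaw Z (gaussianReal 0 v) P)
    {s : Set ℝ} (hs : MeasurableSet s) : P.real {ω | -Z ω ∈ s} = P.real {ω | Z ω ∈ s} := by
  have hZ' : HasLaw (-Z) (gaussianReal 0 v) P := by simpa using gaussianReal_neg hZ
  have h1 := hZ.measure_eq (p := fun x ↦ x ∈ s) hs
  have h2 := hZ'.measure_eq (p := fun x ↦ x ∈ s) hs
  exact congrArg ENNReal.toReal (h2.trans h1.symm)

/-- A centred Gaussian puts mass at most `(y - x) / √(2πv)` on an interval `[x, y]`. -/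
theorem measureReal_gaussian_Icc_le (hZ : HasLaw Z (gaussianReal 0 v) P) (hv : v ≠ 0) {x y : ℝ}
    (hxy : x ≤ y) : P.real {ω | Z ω ∈ Set.Icc x y} ≤ (y - x) / √(2 * Real.pi * v) := by
  have hC : 0 ≤ (√(2 * Real.pi * v))⁻¹ := by positivity
  rw [Measure.real, hZ.measure_eq (p := fun z ↦ z ∈ Set.Icc x y) measurableSet_Icc]
  refine ENNReal.toReal_le_of_le_ofReal (div_nonneg (sub_nonneg.2 hxy) (by positivity)) ?_
  rw [gaussianReal_apply _ hv]
  calc ∫⁻ z in {z | z ∈ Set.Icc x y}, gaussianPDF 0 v z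
      ≤ ∫⁻ _ in Set.Icc x y, ENNReal.ofReal (√(2 * Real.pi * v))⁻¹ := by
        refine lintegral_mono fun z ↦ ENNReal.ofReal_le_ofReal ?_
        rw [gaussianPDFReal]
        refine mul_le_of_le_one_right hC (Real.exp_le_one_iff.2 ?_)
        exact div_nonpos_of_nonpos_of_nonneg (neg_nonpos.2 (sq_nonneg _)) (by positivity)
    _ = ENNReal.ofReal ((y - x) / √(2 * Real.pi * v)) := by
        rw [setLIntegral_const, Real.volume_Icc, ← ENNReal.ofReal_mul hC, div_eq_inv_mul]

variable [IsProbabilityMeasure P]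

theorem one_le_two_mul_measureReal_nonneg (hZ : HasLaw Z (gaussianReal 0 v) P) :
    1 ≤ 2 * P.real {ω | 0 ≤ Z ω} := by
  have h := measureReal_neg_mem_of_gaussian hZ (measurableSet_Ici (a := (0 : ℝ)))
  simp only [Set.mem_Ici] at h
  have hu : P.real (Set.univ : Set Ω) ≤ P.real {ω | 0 ≤ Z ω} + P.real {ω | 0 ≤ -Z ω} := by
    refine (measureReal_mono (fun ω _ ↦ ?_)).trans (measureReal_union_le _ _)
    rcases le_total 0 (Z ω) with h | h
    · exact Or.inl h
    · exact Or.inr (neg_nonneg.2 h)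
  rw [probReal_univ] at hu
  linarith

theorem two_mul_measureReal_pos_le_one (hZ : HasLaw Z (gaussianReal 0 v) P) :
    2 * P.real {ω | 0 < Z ω} ≤ 1 := by
  have h := measureReal_neg_mem_of_gaussian hZ (measurableSet_Ioi (a := (0 : ℝ)))
  simp only [Set.mem_Ioi] at h
  have hd : Disjoint {ω | 0 < Z ω} {ω | 0 < -Z ω} := by
    rw [Set.disjoint_left]
    intro ω h1 h2
    simp only [Set.mem_ofPred_eq] at h1 h2
    linarith
  have hu : P.real ({ω | 0 < Z ω} ∪ {ω | 0 < -Z ω}) =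
      P.real {ω | 0 < Z ω} + P.real {ω | 0 < -Z ω} := by
    rw [Measure.real, measure_union₀
      (show NullMeasurableSet {ω | 0 < -Z ω} P from
        nullMeasurableSet_lt aemeasurable_const hZ.aemeasurable.neg) hd.aedisjoint,
      ENNReal.toReal_add (measure_ne_top _ _) (measure_ne_top _ _)]
    rfl
  have := measureReal_le_one (μ := P) (s := {ω | 0 < Z ω} ∪ {ω | 0 < -Z ω})
  linarith

end Gaussian

section Grid

/-- The `k`-th point of the subdivision of `[0, T]` into `n` equal pieces. -/
noncomputable def gridPoint (T : ℝ≥0) (n k : ℕ) : ℝ≥0 := k * T / n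

theorem gridPoint_zero (T : ℝ≥0) (n : ℕ) : gridPoint T n 0 = 0 := by simp [gridPoint]

theorem gridPoint_mono (T : ℝ≥0) (n : ℕ) : Monotone (gridPoint T n) := fun i j h ↦ by
  unfold gridPoint
  gcongr

theorem gridPoint_self (T : ℝ≥0) {n : ℕ} (hn : n ≠ 0) : gridPoint T n n = T := by
  have : (n : ℝ≥0) ≠ 0 := by exact_mod_cast hn
  rw [gridPoint, mul_comm, mul_div_assoc, div_self this, mul_one]

theorem gridPoint_le (T : ℝ≥0) {n k : ℕ} (hk : k ≤ n) : gridPoint T n k ≤ T := by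
  rcases eq_or_ne n 0 with rfl | hn
  · simp [gridPoint]
  · exact (gridPoint_mono T n hk).trans (gridPoint_self T hn).le

theorem gridPoint_succ (T : ℝ≥0) (n k : ℕ) :
    gridPoint T n (k + 1) = gridPoint T n k + T / n := by
  simp only [gridPoint]
  push_cast
  ring

theorem tendsto_div_natCast (T : ℝ≥0) :
    Filter.Tendsto (fun n : ℕ ↦ T / n) Filter.atTop (nhds 0) := by
  rw [← NNReal.tendsto_coe]
  simpa using tendsto_const_div_atTop_nhds_zero_nat (T : ℝ)

/-- Every point of `[0, T]` is a limit of grid points. -/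
theorem exists_tendsto_gridPoint {T s : ℝ≥0} (hT : 0 < T) (hs : s ≤ T) :
    ∃ κ : ℕ → ℕ, (∀ n, κ n ≤ n) ∧
      Filter.Tendsto (fun n ↦ gridPoint T n (κ n)) Filter.atTop (nhds s) := by
  have hr : (s : ℝ) / T ≤ 1 := div_le_one_of_le₀ (by exact_mod_cast hs) T.2
  refine ⟨fun n ↦ ⌊(s : ℝ) / T * n⌋₊, fun n ↦ ?_, ?_⟩
  · exact Nat.floor_le_of_le (mul_le_of_le_one_left n.cast_nonneg hr)
  · rw [← NNReal.tendsto_coe]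
    have h := ((tendsto_nat_floor_mul_div_atTop (R := ℝ) (a := (s : ℝ) / T)
      (by positivity)).comp tendsto_natCast_atTop_atTop).mul_const (T : ℝ)
    rw [div_mul_cancel₀ _ (by exact_mod_cast hT.ne')] at h
    refine h.congr fun n ↦ ?_
    simp [gridPoint]
    ring

/-- The minimum of `f` over the grid of `[a, b]` with `n` pieces. -/
noncomputable def gridMin (a b : ℝ≥0) (f : ℝ≥0 → ℝ) (n : ℕ) : ℝ :=
  (Finset.range (n + 1)).inf' Finset.nonempty_range_add_one fun k ↦ f (a + gridPoint (b - a) n k)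

theorem add_gridPoint_mem_Icc {a b : ℝ≥0} (hab : a ≤ b) {n k : ℕ} (hk : k ≤ n) :
    a + gridPoint (b - a) n k ∈ Set.Icc a b :=
  ⟨le_self_add, by
    have := add_le_add_right (gridPoint_le (b - a) hk) a
    rwa [add_tsub_cancel_of_le hab] at this⟩

theorem bddBelow_range_abs (f : ℝ≥0 → ℝ) (a b : ℝ≥0) :
    BddBelow (Set.range fun t : Set.Icc a b ↦ |f t|) :=
  ⟨0, by rintro _ ⟨t, rfl⟩; exact abs_nonneg _⟩

theorem iInf_abs_le_gridMin (f : ℝ≥0 → ℝ) {a b : ℝ≥0} (hab : a ≤ b) (n : ℕ) :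
    ⨅ t : Set.Icc a b, |f t| ≤ gridMin a b (fun t ↦ |f t|) n := by
  refine Finset.le_inf' _ _ fun k hk ↦ ?_
  exact ciInf_le (bddBelow_range_abs f a b)
    ⟨_, add_gridPoint_mem_Icc hab (Nat.lt_succ_iff.1 (Finset.mem_range.1 hk))⟩

/-- Grid minima of a continuous function converge to its infimum. -/
theorem tendsto_gridMin {f : ℝ≥0 → ℝ} (hf : Continuous f) {a b : ℝ≥0} (hab : a < b) :
    Filter.Tendsto (gridMin a b fun t ↦ |f t|) Filter.atTop
      (nhds (⨅ t : Set.Icc a b, |f t|)) := by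
  have : Nonempty (Set.Icc a b) := ⟨⟨a, le_rfl, hab.le⟩⟩
  refine tendsto_order.2 ⟨fun c hc ↦ ?_, fun c hc ↦ ?_⟩
  · exact Filter.Eventually.of_forall fun n ↦ hc.trans_le (iInf_abs_le_gridMin f hab.le n)
  · obtain ⟨⟨t, ht⟩, htc⟩ := exists_lt_of_ciInf_lt hc
    obtain ⟨κ, hκ, hlim⟩ := exists_tendsto_gridPoint (T := b - a) (s := t - a)
      (tsub_pos_of_lt hab) (tsub_le_tsub_right ht.2 a)
    have h1 : Filter.Tendsto (fun n ↦ |f (a + gridPoint (b - a) n (κ n))|) Filter.atTop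
        (nhds |f t|) := by
      have h2 : Continuous fun x : ℝ≥0 ↦ |f (a + x)| := by fun_prop
      have := (h2.tendsto (t - a)).comp hlim
      rwa [add_tsub_cancel_of_le ht.1] at this
    filter_upwards [h1.eventually_lt_const htc] with n hn
    exact (Finset.inf'_le (fun k ↦ |f (a + gridPoint (b - a) n k)|)
      (Finset.mem_range.2 (Nat.lt_succ_iff.2 (hκ n)))).trans_lt hn

/-- A continuous function positive at `a` whose modulus does not vanish on `[a, b]` is positive
on `[a, b]`. -/
theorem pos_of_iInf_abs_pos {f : ℝ≥0 → ℝ} (hf : Continuous f) {a b t : ℝ≥0}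
    (hpos : 0 < ⨅ t : Set.Icc a b, |f t|) (ha : 0 < f a) (ht : t ∈ Set.Icc a b) : 0 < f t := by
  by_contra! hneg
  obtain ⟨s, hs, hs0⟩ := intermediate_value_Icc' ht.1 hf.continuousOn ⟨hneg, ha.le⟩
  have := ciInf_le (bddBelow_range_abs f a b) ⟨s, hs.1, hs.2.trans ht.2⟩
  simp only [hs0, abs_zero] at this
  linarith

end Grid

section Brownian

variable {Ω : Type*} [MeasurableSpace Ω] {P : Measure Ω} {B W : ℝ≥0 → Ω → ℝ}

theorem indepFun_grid_increment (hB : IsPreBrownianReal B P) (T : ℝ≥0) {n k : ℕ} (hn : n ≠ 0)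
    (hk : k ≤ n) :
    IndepFun (fun ω (j : Fin (k + 1)) ↦ B (gridPoint T n j) ω)
      (fun ω ↦ B (gridPoint T n n) ω - B (gridPoint T n k) ω) P := by
  have hj (j : Fin (k + 1)) : gridPoint T n j ∈ Set.Iic (gridPoint T n k) :=
    gridPoint_mono T n (Nat.lt_succ_iff.1 j.2)
  have h : IndepFun (fun ω (j : Fin (k + 1)) ↦ B (gridPoint T n j) ω)
      (fun ω ↦ B (gridPoint T n k + (T - gridPoint T n k)) ω - B (gridPoint T n k) ω) P :=
    (hB.indepFun_shift (gridPoint T n k)).symm.comp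
    (φ := fun (x : Set.Iic (gridPoint T n k) → ℝ) (j : Fin (k + 1)) ↦ x ⟨gridPoint T n j, hj j⟩)
    (ψ := fun (y : ℝ≥0 → ℝ) ↦ y (T - gridPoint T n k)) (by fun_prop) (by fun_prop)
  rw [add_tsub_cancel_of_le (gridPoint_le T hk)] at h
  rwa [gridPoint_self T hn]

theorem eventually_measureReal_exists_increment_le [IsProbabilityMeasure P]
    (hB : IsBrownianReal B P) (T : ℝ≥0) {ε δ : ℝ} (hε : 0 < ε) (hδ : 0 < δ) :
    ∀ᶠ n in Filter.atTop,
      P.real {ω | ∃ k < n, ε ≤ B (gridPoint T n (k + 1)) ω - B (gridPoint T n k) ω} ≤ δ := by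
  have key : ∀ᵐ ω ∂P, ω ∈ Set.univ → ∀ᶠ n in Filter.atTop,
      ω ∈ {ω | ∃ k < n, ε ≤ B (gridPoint T n (k + 1)) ω - B (gridPoint T n k) ω}ᶜ := by
    filter_upwards [hB.cont] with ω hω _
    obtain ⟨r, hr, hr'⟩ := Metric.uniformContinuousOn_iff.1
      ((isCompact_Icc (a := (0 : ℝ≥0)) (b := T)).uniformContinuousOn_of_continuous
        hω.continuousOn) ε hε
    filter_upwards [(Metric.tendsto_atTop'.1 (tendsto_div_natCast T) r hr).elim
      fun N hN ↦ Filter.eventually_atTop.2 ⟨N + 1, fun n hn ↦ hN n (by omega)⟩] with n hn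
    rintro ⟨k, hk, hk'⟩
    have h1 := hr' (gridPoint T n (k + 1)) ⟨zero_le, gridPoint_le T hk⟩
      (gridPoint T n k) ⟨zero_le, gridPoint_le T hk.le⟩ (by
        rw [gridPoint_succ, NNReal.dist_eq]
        rw [NNReal.dist_eq] at hn
        simpa using hn)
    rw [Real.dist_eq] at h1
    linarith [le_abs_self (B (gridPoint T n (k + 1)) ω - B (gridPoint T n k) ω)]
  filter_upwards [eventually_measureReal_le_add key hδ] with n hn
  have hnull : NullMeasurableSet
      {ω | ∃ k < n, ε ≤ B (gridPoint T n (k + 1)) ω - B (gridPoint T n k) ω} P := by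
    have : {ω | ∃ k < n, ε ≤ B (gridPoint T n (k + 1)) ω - B (gridPoint T n k) ω} =
        ⋃ k ∈ Finset.range n,
          {ω | ε ≤ B (gridPoint T n (k + 1)) ω - B (gridPoint T n k) ω} := by
      ext; simp
    rw [this]
    exact Finset.nullMeasurableSet_biUnion _ fun k _ ↦
      nullMeasurableSet_le aemeasurable_const ((hB.aemeasurable _).sub (hB.aemeasurable _))
  rw [Set.compl_eq_univ_sdiff, measureReal_diff_of_subset (Set.subset_univ _) hnull] at hn
  linarith

/-- Anti-concentration of the maximum of a Brownian motion over a grid. -/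
theorem measureReal_brownian_max_mem_le [IsProbabilityMeasure P] (hB : IsPreBrownianReal B P)
    (h0 : ∀ ω, B 0 ω = 0) {T : ℝ≥0} (hT : 0 < T) {n : ℕ} (hn : n ≠ 0) (x : ℝ) {η ε : ℝ}
    (hη : 0 < η) (hε : 0 < ε) :
    P.real {ω | (∀ k ≤ n, B (gridPoint T n k) ω < x) ∧
        ∃ k ≤ n, x - η < B (gridPoint T n k) ω} ≤
      2 * ((η + ε) / √(2 * Real.pi * T)) +
      2 * P.real {ω | ∃ k < n, ε ≤ B (gridPoint T n (k + 1)) ω - B (gridPoint T n k) ω} := by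
  have hlaw (k : ℕ) := hB.hasLaw_sub (gridPoint T n n) (gridPoint T n k)
  have h00 (ω : Ω) : B (gridPoint T n 0) ω = 0 := by rw [gridPoint_zero, h0]
  have hmain := measureReal_max_mem_le (P := P) (S := fun k ↦ B (gridPoint T n k)) (n := n)
    (fun k ↦ hB.aemeasurable _) h00 (fun k hk ↦ indepFun_grid_increment hB T hn hk)
    (fun k _ ↦ one_le_two_mul_measureReal_nonneg (hlaw k))
    (fun k _ ↦ two_mul_measureReal_pos_le_one (hlaw k)) (le_max_right (x - η) 0) hη hε
  have hG := measureReal_gaussian_Icc_le (hB.hasLaw_eval T) hT.ne'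
    (x := max (x - η) 0) (y := max (x - η) 0 + η + ε) (by linarith)
  have e1 : P.real {ω | (∀ k ≤ n, B (gridPoint T n k) ω < x) ∧
        ∃ k ≤ n, x - η < B (gridPoint T n k) ω} ≤
      P.real {ω | (∃ k ≤ n, max (x - η) 0 ≤ B (gridPoint T n k) ω) ∧
        ∀ k ≤ n, B (gridPoint T n k) ω < max (x - η) 0 + η} := by
    refine measureReal_mono ?_ (measure_ne_top _ _)
    rintro ω ⟨h1, k, hk, hk'⟩
    refine ⟨?_, fun j hj ↦ (h1 j hj).trans_le (by linarith [le_max_left (x - η) 0])⟩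
    rcases le_total (x - η) 0 with h | h
    · exact ⟨0, n.zero_le, by rw [max_eq_right h, h00]⟩
    · exact ⟨k, hk, by rw [max_eq_left h]; exact hk'.le⟩
  have e2 : P.real {ω | max (x - η) 0 ≤ B (gridPoint T n n) ω ∧
      B (gridPoint T n n) ω < max (x - η) 0 + η + ε} ≤
      (η + ε) / √(2 * Real.pi * T) := by
    rw [gridPoint_self T hn]
    refine (measureReal_mono ?_ (measure_ne_top _ _)).trans (hG.trans_eq ?_)
    · exact fun ω hω ↦ ⟨hω.1, hω.2.le⟩
    · congr 1; ring
  linarith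

/-- The event that a Brownian motion is positive on a grid with minimum less than `η`. -/
theorem measureReal_gridMin_mem_le [IsProbabilityMeasure P] (hW : IsPreBrownianReal W P)
    {a T : ℝ≥0} (ha : 0 < a) (hT : 0 < T) {n : ℕ} (hn : n ≠ 0) {η ε : ℝ}
    (hη : 0 < η) (hε : 0 < ε) :
    P.real {ω | (∀ k ≤ n, 0 < W (a + gridPoint T n k) ω) ∧
        ∃ k ≤ n, W (a + gridPoint T n k) ω < η} ≤ η / √(2 * Real.pi * a) ∧
    P.real {ω | (∀ k ≤ n, 0 < W (a + gridPoint T n k) ω) ∧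
        ∃ k ≤ n, W (a + gridPoint T n k) ω < η} ≤
      2 * ((η + ε) / √(2 * Real.pi * T)) +
      2 * P.real {ω | ∃ k < n, ε ≤ (-(fun t ω ↦ W (a + t) ω - W a ω)) (gridPoint T n (k + 1)) ω -
        (-(fun t ω ↦ W (a + t) ω - W a ω)) (gridPoint T n k) ω} := by
  set N : ℝ≥0 → Ω → ℝ := -(fun t ω ↦ W (a + t) ω - W a ω) with hN
  have hNB : IsPreBrownianReal N P := (hW.shift a).neg
  have hN0 (ω : Ω) : N 0 ω = 0 := by simp [hN]
  have hind : IndepFun (W a) (fun ω (k : Fin (n + 1)) ↦ N (gridPoint T n k) ω) P :=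
    (hW.indepFun_shift a).symm.comp (φ := fun (x : Set.Iic a → ℝ) ↦ x ⟨a, Set.self_mem_Iic⟩)
      (ψ := fun (y : ℝ≥0 → ℝ) (k : Fin (n + 1)) ↦ -(y (gridPoint T n k))) (by fun_prop) (by fun_prop)
  have hYm : AEMeasurable (fun ω (k : Fin (n + 1)) ↦ N (gridPoint T n k) ω) P :=
    aemeasurable_pi_lambda _ fun k ↦ hNB.aemeasurable _
  let D : Set (ℝ × (Fin (n + 1) → ℝ)) :=
    (⋂ k, {p | p.2 k < p.1}) ∩ ⋃ k, {p | p.1 - η < p.2 k}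
  have hD : MeasurableSet D := by
    refine (MeasurableSet.iInter fun k ↦ ?_).inter (MeasurableSet.iUnion fun k ↦ ?_)
    · exact measurableSet_lt (by fun_prop) (by fun_prop)
    · exact measurableSet_lt (by fun_prop) (by fun_prop)
  have hev : {ω | (∀ k ≤ n, 0 < W (a + gridPoint T n k) ω) ∧
        ∃ k ≤ n, W (a + gridPoint T n k) ω < η} =
      {ω | (W a ω, fun k : Fin (n + 1) ↦ N (gridPoint T n k) ω) ∈ D} := by
    ext ω
    have h1 (t : ℝ≥0) : N t ω = W a ω - W (a + t) ω := by simp [hN]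
    simp [D, h1, Fin.forall_iff, Fin.exists_iff]
  rw [hev]
  constructor
  · refine measureReal_pair_le_of_forall (hW.aemeasurable a) hYm hind hD (by positivity)
      fun y ↦ ?_
    have hne : (Finset.univ : Finset (Fin (n + 1))).Nonempty := Finset.univ_nonempty
    have hG := measureReal_gaussian_Icc_le (hW.hasLaw_eval a) ha.ne'
      (x := Finset.univ.sup' hne y) (y := Finset.univ.sup' hne y + η) (by linarith)
    refine (measureReal_mono ?_ (measure_ne_top _ _)).trans (hG.trans_eq (by congr 1; ring))
    rintro ω ⟨h1, h2⟩
    simp only [Set.mem_iInter, Set.mem_iUnion, Set.mem_ofPred_eq] at h1 h2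
    obtain ⟨k, hk⟩ := h2
    exact ⟨Finset.sup'_le _ _ fun j _ ↦ (h1 j).le, by
      linarith [Finset.le_sup' y (Finset.mem_univ k)]⟩
  · have hsymm := measureReal_pair_le_of_forall hYm (hW.aemeasurable a) hind.symm
      (B := Prod.swap ⁻¹' D) (measurable_swap hD)
      (C := 2 * ((η + ε) / √(2 * Real.pi * T)) + 2 * P.real {ω | ∃ k < n,
        ε ≤ N (gridPoint T n (k + 1)) ω - N (gridPoint T n k) ω})
      (by positivity) fun x ↦ ?_
    · exact hsymm
    · refine le_trans (measureReal_mono ?_ (measure_ne_top _ _))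
        (measureReal_brownian_max_mem_le hNB hN0 hT hn x hη hε)
      rintro ω ⟨h1, h2⟩
      simp only [Set.mem_iInter, Set.mem_iUnion, Set.mem_ofPred_eq, Prod.swap_prod_mk] at h1 h2
      obtain ⟨k, hk⟩ := h2
      exact ⟨fun j hj ↦ h1 ⟨j, Nat.lt_succ_iff.2 hj⟩, k, Nat.lt_succ_iff.1 k.2, hk⟩

theorem measureReal_localInf_mem_pos_le [IsProbabilityMeasure P] (hW : IsBrownianReal W P)
    {a b : ℝ≥0} (ha : 0 < a) (hab : a < b) {η : ℝ} (hη : 0 < η) :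
    P.real {ω | 0 < localInf W a b ω ∧ localInf W a b ω ≤ η ∧ 0 < W a ω} ≤
        η / √(2 * Real.pi * a) ∧
    P.real {ω | 0 < localInf W a b ω ∧ localInf W a b ω ≤ η ∧ 0 < W a ω} ≤
        2 * (η / √(2 * Real.pi * (b - a : ℝ≥0))) := by
  have hT : 0 < b - a := tsub_pos_of_lt hab
  set A : Set Ω := {ω | 0 < localInf W a b ω ∧ localInf W a b ω ≤ η ∧ 0 < W a ω}
  have hlim {δ : ℝ} (hδ : 0 < δ) : ∀ᶠ n in Filter.atTop, P.real A ≤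
      P.real {ω | (∀ k ≤ n, 0 < W (a + gridPoint (b - a) n k) ω) ∧
        ∃ k ≤ n, W (a + gridPoint (b - a) n k) ω < η + δ} + δ := by
    refine eventually_measureReal_le_add ?_ hδ
    filter_upwards [hW.cont] with ω hω ⟨h1, h2, h3⟩
    have hpos {n k : ℕ} (hk : k ≤ n) : 0 < W (a + gridPoint (b - a) n k) ω :=
      pos_of_iInf_abs_pos hω h1 h3 (add_gridPoint_mem_Icc hab.le hk)
    filter_upwards [(tendsto_gridMin hω hab).eventually_lt_const
      (show _ < η + δ from h2.trans_lt (by linarith))] with n hn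
    refine ⟨fun k hk ↦ hpos hk, ?_⟩
    obtain ⟨k, hk, hk'⟩ := (Finset.inf'_lt_iff _).1 hn
    have hk : k ≤ n := Nat.lt_succ_iff.1 (Finset.mem_range.1 hk)
    exact ⟨k, hk, (le_abs_self _).trans_lt hk'⟩
  have hsmall {f : ℝ → ℝ} (hf : Continuous f) (h : ∀ δ > 0, P.real A ≤ f δ) :
      P.real A ≤ f 0 :=
    ge_of_tendsto ((hf.tendsto 0).mono_left (nhdsWithin_le_nhds (s := Set.Ioi 0)))
      (Filter.eventually_of_mem self_mem_nhdsWithin h)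
  constructor
  · refine (hsmall (f := fun δ ↦ (η + δ) / √(2 * Real.pi * a) + δ) (by fun_prop)
      fun δ hδ ↦ ?_).trans_eq (by simp)
    obtain ⟨n, hn, hn0⟩ := ((hlim hδ).and (Filter.eventually_ne_atTop 0)).exists
    have := (measureReal_gridMin_mem_le hW.toIsPreBrownianReal ha hT hn0
      (show 0 < η + δ by linarith) hδ).1
    linarith
  · refine (hsmall (f := fun δ ↦ 2 * ((η + δ + δ) / √(2 * Real.pi * (b - a : ℝ≥0))) + 3 * δ)
      (by fun_prop) fun δ hδ ↦ ?_).trans_eq (by simp)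
    obtain ⟨n, ⟨hn, hn0⟩, hn'⟩ := (((hlim hδ).and (Filter.eventually_ne_atTop 0)).and
      (eventually_measureReal_exists_increment_le (hW.shift a).neg (b - a) hδ hδ)).exists
    have := (measureReal_gridMin_mem_le hW.toIsPreBrownianReal ha hT hn0
      (show 0 < η + δ by linarith) hδ).2
    linarith

theorem aemeasurable_localInf (hW : IsBrownianReal W P) {a b : ℝ≥0} (hab : a < b) :
    AEMeasurable (localInf W a b) P := by
  refine aemeasurable_of_tendsto_metrizable_ae Filter.atTop
    (f := fun n ω ↦ gridMin a b (fun t ↦ |W t ω|) n) (fun n ↦ ?_) ?_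
  · have : (fun ω ↦ gridMin a b (fun t ↦ |W t ω|) n) = (Finset.range (n + 1)).inf'
        Finset.nonempty_range_add_one fun k ω ↦ |W (a + gridPoint (b - a) n k) ω| := by
      ext ω
      simp [gridMin, Finset.inf'_apply]
    rw [this]
    exact Finset.inf'_induction _ _ (p := fun f ↦ AEMeasurable f P) (fun _ h _ h' ↦ h.inf h')
      fun k _ ↦ (hW.aemeasurable _).abs
  · filter_upwards [hW.cont] with ω hω
    exact tendsto_gridMin hω hab

omit [MeasurableSpace Ω] in
theorem localInf_neg (W : ℝ≥0 → Ω → ℝ) (a b : ℝ≥0) : localInf (-W) a b = localInf W a b := by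
  ext ω
  simp [localInf]

omit [MeasurableSpace Ω] in
theorem localInf_le_abs (W : ℝ≥0 → Ω → ℝ) {a b : ℝ≥0} (hab : a ≤ b) (ω : Ω) :
    localInf W a b ω ≤ |W a ω| :=
  ciInf_le (bddBelow_range_abs (W · ω) a b) ⟨a, le_rfl, hab⟩

theorem measureReal_localInf_mem_le [IsProbabilityMeasure P] (hW : IsBrownianReal W P)
    {a b : ℝ≥0} (ha : 0 < a) (hab : a < b) {η : ℝ} (hη : 0 < η) :
    P.real {ω | 0 < localInf W a b ω ∧ localInf W a b ω ≤ η} ≤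
      4 * η / √(2 * Real.pi) * min (1 / √((b : ℝ) - (a : ℝ))) (1 / √(a : ℝ)) := by
  obtain ⟨h1, h2⟩ := measureReal_localInf_mem_pos_le hW ha hab hη
  obtain ⟨h3, h4⟩ := measureReal_localInf_mem_pos_le hW.neg ha hab hη
  rw [localInf_neg] at h3 h4
  have hsplit : P.real {ω | 0 < localInf W a b ω ∧ localInf W a b ω ≤ η} ≤
      P.real {ω | 0 < localInf W a b ω ∧ localInf W a b ω ≤ η ∧ 0 < W a ω} +
      P.real {ω | 0 < localInf W a b ω ∧ localInf W a b ω ≤ η ∧ 0 < (-W) a ω} := by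
    refine (measureReal_mono ?_ (measure_ne_top _ _)).trans (measureReal_union_le _ _)
    rintro ω ⟨hω1, hω2⟩
    have := abs_pos.1 (hω1.trans_le (localInf_le_abs W hab.le ω))
    rcases lt_or_gt_of_ne this with h | h
    · exact Or.inr ⟨hω1, hω2, neg_pos.2 h⟩
    · exact Or.inl ⟨hω1, hω2, h⟩
  have hfac (v : ℝ) : η / √(2 * Real.pi * v) = η / √(2 * Real.pi) * (1 / √v) := by
    rw [Real.sqrt_mul (by positivity)]
    field_simp
  rw [hfac] at h1 h2 h3 h4
  rw [NNReal.coe_sub hab.le] at h2 h4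
  have hpos : 0 ≤ η / √(2 * Real.pi) * (1 / √(a : ℝ)) := by positivity
  rw [mul_div_assoc, mul_min_of_nonneg _ _ (by positivity), le_min_iff]
  constructor <;> linarith

end Brownian

section NegativeMoment

variable {Ω : Type*} [MeasurableSpace Ω] {P : Measure Ω}

/-- A random variable with linearly bounded mass near `0+` has negative moments of order less
than one on the event that it is positive. -/
theorem integrable_and_integral_inv_rpow_le [IsProbabilityMeasure P] {β : Ω → ℝ}
    (hβ : AEMeasurable β P) {C : ℝ} (hC : 0 ≤ C)
    (h : ∀ η : ℝ, 0 < η → P.real {ω | 0 < β ω ∧ β ω ≤ η} ≤ C * η) {α : ℝ} (hα : 0 ≤ α)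
    (hα1 : α < 1) :
    Integrable ({ω | 0 < β ω}.indicator fun ω ↦ 1 / β ω ^ α) P ∧
      ∫ ω, {ω | 0 < β ω}.indicator (fun ω ↦ 1 / β ω ^ α) ω ∂P ≤ C / (1 - α) + 1 := by
  set f : Ω → ℝ := {ω | 0 < β ω}.indicator fun ω ↦ 1 / β ω ^ α with hf
  have hfm : AEMeasurable f P := by
    have hg : Measurable ((Set.Ioi (0 : ℝ)).indicator fun x ↦ 1 / x ^ α) :=
      Measurable.indicator (by fun_prop) measurableSet_Ioi
    exact hg.comp_aemeasurable hβ
  have hf0 (ω : Ω) : 0 ≤ f ω := Set.indicator_nonneg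
    (fun ω (hω : 0 < β ω) ↦ one_div_nonneg.2 (Real.rpow_nonneg hω.le α)) ω
  have hα' : 0 < 1 - α := by linarith
  have hR : 0 ≤ C / (1 - α) + 1 := by positivity
  have hle1 : ∫⁻ t in Set.Ioc (0 : ℝ) 1, P {ω | t < f ω} ≤ 1 := by
    calc ∫⁻ t in Set.Ioc (0 : ℝ) 1, P {ω | t < f ω}
        ≤ ∫⁻ _ in Set.Ioc (0 : ℝ) 1, 1 := lintegral_mono fun _ ↦ prob_le_one
      _ = 1 := by simp
  have hgt1 : ∫⁻ t in Set.Ioi (1 : ℝ), P {ω | t < f ω} ≤ ENNReal.ofReal (C / (1 - α)) := by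
    rcases hα.eq_or_lt with rfl | hαpos
    · have : ∀ t ∈ Set.Ioi (1 : ℝ), P {ω | t < f ω} = 0 := by
        intro t (ht : 1 < t)
        convert measure_empty (μ := P)
        refine Set.eq_empty_iff_forall_notMem.2 fun ω (hω : t < f ω) ↦ ?_
        have : f ω ≤ 1 := by
          simp only [hf, Real.rpow_zero, div_one]
          exact Set.indicator_le_self' (fun _ _ ↦ zero_le_one) ω
        linarith
      rw [setLIntegral_congr_fun measurableSet_Ioi this]
      simp
    · have hexp : -α⁻¹ < -1 := neg_lt_neg ((one_lt_inv₀ hαpos).2 hα1)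
      have hpt : ∀ t ∈ Set.Ioi (1 : ℝ), P {ω | t < f ω} ≤ ENNReal.ofReal (C * t ^ (-α⁻¹)) := by
        intro t (ht : 1 < t)
        have ht0 : 0 < t := by linarith
        have hη : 0 < t ^ (-α⁻¹) := Real.rpow_pos_of_pos ht0 _
        refine (ENNReal.le_ofReal_iff_toReal_le (measure_ne_top _ _) (by positivity)).2
          ((measureReal_mono ?_ (measure_ne_top _ _)).trans (h _ hη))
        intro ω (hω : t < f ω)
        by_cases hpos : 0 < β ω
        · refine ⟨hpos, ?_⟩
          rw [hf, Set.indicator_of_mem (show ω ∈ {ω | 0 < β ω} from hpos)] at hω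
          rw [Real.rpow_neg ht0.le, ← Real.inv_rpow ht0.le]
          refine (Real.le_rpow_inv_iff_of_pos hpos.le (inv_nonneg.2 ht0.le) hαpos).2 ?_
          rw [lt_one_div ht0 (Real.rpow_pos_of_pos hpos α)] at hω
          rw [inv_eq_one_div]
          exact hω.le
        · rw [hf, Set.indicator_of_notMem (show ω ∉ {ω | 0 < β ω} from hpos)] at hω
          linarith
      have hint : IntegrableOn (fun t : ℝ ↦ C * t ^ (-α⁻¹)) (Set.Ioi 1) :=
        (integrableOn_Ioi_rpow_of_lt hexp one_pos).const_mul C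
      calc ∫⁻ t in Set.Ioi (1 : ℝ), P {ω | t < f ω}
          ≤ ∫⁻ t in Set.Ioi (1 : ℝ), ENNReal.ofReal (C * t ^ (-α⁻¹)) :=
            setLIntegral_mono' measurableSet_Ioi hpt
        _ = ENNReal.ofReal (∫ t in Set.Ioi (1 : ℝ), C * t ^ (-α⁻¹)) := by
            rw [ofReal_integral_eq_lintegral_ofReal hint]
            filter_upwards [ae_restrict_mem measurableSet_Ioi] with t (ht : 1 < t)
            exact mul_nonneg hC (Real.rpow_nonneg (by linarith) _)
        _ ≤ ENNReal.ofReal (C / (1 - α)) := by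
            refine ENNReal.ofReal_le_ofReal ?_
            rw [integral_const_mul, integral_Ioi_rpow_of_lt hexp one_pos, Real.one_rpow,
              div_eq_mul_inv C]
            refine mul_le_mul_of_nonneg_left ?_ hC
            have e : -1 / (-α⁻¹ + 1) = α * (1 - α)⁻¹ := by
              have : -α⁻¹ + 1 = -((1 - α) / α) := by field_simp; ring
              rw [this, neg_div_neg_eq, one_div_div, div_eq_mul_inv]
            rw [e]
            exact mul_le_of_le_one_left (inv_nonneg.2 hα'.le) hα1.le
  have hlin : ∫⁻ ω, ENNReal.ofReal (f ω) ∂P ≤ ENNReal.ofReal (C / (1 - α) + 1) := by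
    rw [lintegral_eq_lintegral_meas_lt P (Filter.Eventually.of_forall hf0) hfm,
      ← Set.Ioc_union_Ioi_eq_Ioi (zero_le_one (α := ℝ)),
      lintegral_union measurableSet_Ioi Set.Ioc_disjoint_Ioi_same,
      ENNReal.ofReal_add (by positivity) zero_le_one, ENNReal.ofReal_one, add_comm]
    exact add_le_add hgt1 hle1
  refine ⟨⟨hfm.aestronglyMeasurable, ?_⟩, ?_⟩
  · rw [hasFiniteIntegral_iff_ofReal (Filter.Eventually.of_forall hf0)]
    exact hlin.trans_lt ENNReal.ofReal_lt_top
  · rw [integral_eq_lintegral_of_nonneg_ae (Filter.Eventually.of_forall hf0)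
      hfm.aestronglyMeasurable]
    exact ENNReal.toReal_le_of_le_ofReal hR hlin

end NegativeMoment

theorem mainTheorem2 {Ω : Type*} [MeasurableSpace Ω] (P : Measure Ω) (W : ℝ≥0 → Ω → ℝ)
    (hW : IsBrownianReal W P) (a b : ℝ≥0) (ha : 0 < a) (hab : a < b) :
    (∀ η : ℝ, 0 < η →
      P.real {ω | 0 < localInf W a b ω ∧ localInf W a b ω ≤ η} ≤
        16 * η / √(2 * Real.pi) * min (1 / √((b : ℝ) - (a : ℝ))) (1 / √(a : ℝ))) ∧
    (∀ α : ℝ, 0 ≤ α → α < 1 →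
      Integrable
        ({ω | 0 < localInf W a b ω}.indicator fun ω => 1 / localInf W a b ω ^ α) P ∧
      ∫ ω, {ω | 0 < localInf W a b ω}.indicator (fun ω => 1 / localInf W a b ω ^ α) ω ∂P ≤
        47 / (1 - α) * min (1 / √((b : ℝ) - (a : ℝ))) (1 / √(a : ℝ)) + 1) := by
  have := hW.isGaussianProcess.isProbabilityMeasure
  set m : ℝ := min (1 / √((b : ℝ) - (a : ℝ))) (1 / √(a : ℝ))
  have hm : 0 ≤ m := le_min (by positivity) (by positivity)
  have hsqrt : 1 ≤ √(2 * Real.pi) := Real.one_le_sqrt.2 (by linarith [Real.pi_gt_three])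
  have hbound {η : ℝ} (hη : 0 < η) := measureReal_localInf_mem_le hW ha hab hη
  refine ⟨fun η hη ↦ (hbound hη).trans ?_, fun α hα hα1 ↦ ?_⟩
  · gcongr
    norm_num
  · have hlin (η : ℝ) (hη : 0 < η) :
        P.real {ω | 0 < localInf W a b ω ∧ localInf W a b ω ≤ η} ≤ 4 * m * η := by
      calc _ ≤ 4 * η / √(2 * Real.pi) * m := hbound hη
        _ ≤ 4 * η * m := by
            gcongr
            exact div_le_self (by positivity) hsqrt
        _ = 4 * m * η := by ring
    obtain ⟨h1, h2⟩ := integrable_and_integral_inv_rpow_le (aemeasurable_localInf hW hab)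
      (by positivity) hlin hα hα1
    refine ⟨h1, h2.trans ?_⟩
    have : 0 < 1 - α := by linarith
    rw [div_mul_eq_mul_div]
    gcongr
    norm_num
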